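/- Let $\alpha>0$ and let $\mathcal F^\infty_\alpha$ be the space of entire functions $f$ with $$\|f\|_{\alpha,\infty}:=\sup_{z\in\mathbb C}|f(z)|e^{-\frac{\alpha}{2}|z|^2}<\infty .$$ Let $X=\{(\lambda,m_\lambda)\}_{\lambda\in\Lambda}$ be a divisor, that is, a countable family $\Lambda$ of points of $\mathbb C$ with associated multiplicities $m_\lambda\in\mathbb N$. For $\lambda\in\Lambda$ put $$N^\infty_\lambda=\{f\in\mathcal F^\infty_\alpha: f(\lambda)=f'(\lambda)=\dots=f^{(m_\lambda-1)}(\lambda)=0\},\qquad \|f\|_{\mathcal F^\infty_\alpha/N^\infty_\lambda}=\inf_{g\in N^\infty_\lambda}\|f-g\|_{\alpha,\infty}.$$ $X$ is called sampling for $\mathcal F^\infty_\alpha$ if there is $L>0$ such that $\|f\|_{\alpha,\infty}\le L\sup_{\lambda\in\Lambda}\|f\|_{\mathcal F^\infty_\alpha/N^\infty_\lambda}$ for all $f\in\mathcal F^\infty_\alpha$ (the supremum over an empty family being $0$). Let $D(z,r)$ denote the open disc of center $z$ and radius $r$. (a) If $X$ is sampling for $\mathcal F^\infty_\alpha$, then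 there exists $C>0$ such that $$\bigcup_{\lambda\in\Lambda}D\bigl(\lambda,\sqrt{m_\lambda/\alpha}+C\bigr)=\mathbb C .$$ (b) Conversely, if for some $C>0$ and some compact set $K\subset\mathbb C$ we have $$\mathbb C\setminus K\subset\bigcup_{\lambda\in\Lambda,\ m_\lambda>\alpha C^2}D\bigl(\lambda,\sqrt{m_\lambda/\alpha}-C\bigr),$$ then $X$ is sampling for $\mathcal F^\infty_\alpha$. -/

import Mathlib

open Set Metric

noncomputable section

namespace Fock

/-- The weighted modulus `|f(z)| e^{-α|z|²/2}`. -/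
def weightedAbs (α : ℝ) (f : ℂ → ℂ) (z : ℂ) : ℝ :=
  ‖f z‖ * Real.exp (-(α / 2) * ‖z‖ ^ 2)

/-- The Fock space `F^∞_α`: entire functions whose weighted modulus is bounded on `ℂ`. -/
def space (α : ℝ) : Submodule ℂ (ℂ → ℂ) where
  carrier := {f | Differentiable ℂ f ∧ BddAbove (range (weightedAbs α f))}
  zero_mem' := by
    refine ⟨differentiable_const (0 : ℂ), 0, ?_⟩
    rintro _ ⟨z, rfl⟩
    simp [weightedAbs]
  add_mem' := by
    rintro f g ⟨hf, a, ha⟩ ⟨hg, b, hb⟩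
    refine ⟨hf.add hg, a + b, ?_⟩
    rintro _ ⟨z, rfl⟩
    calc weightedAbs α (f + g) z ≤ weightedAbs α f z + weightedAbs α g z := by
          unfold weightedAbs
          rw [← add_mul]
          exact mul_le_mul_of_nonneg_right (norm_add_le _ _) (Real.exp_pos _).le
      _ ≤ a + b := add_le_add (ha ⟨z, rfl⟩) (hb ⟨z, rfl⟩)
  smul_mem' := by
    rintro c f ⟨hf, a, ha⟩
    refine ⟨hf.const_smul c, ‖c‖ * a, ?_⟩
    rintro _ ⟨z, rfl⟩
    have h : weightedAbs α (c • f) z = ‖c‖ * weightedAbs α f z := by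
      simp [weightedAbs, mul_assoc]
    rw [h]
    exact mul_le_mul_of_nonneg_left (ha ⟨z, rfl⟩) (norm_nonneg c)

/-- The norm `‖f‖_{α,∞} = sup_z |f(z)| e^{-α|z|²/2}`, a finite supremum for `f` in `space α`. -/
def supNorm (α : ℝ) (f : ℂ → ℂ) : ℝ :=
  ⨆ z : ℂ, weightedAbs α f z

/-- The subspace `N^∞_{w,m}` of the functions in `F^∞_α` with
`f(w) = f'(w) = ⋯ = f^{(m-1)}(w) = 0`. -/
def vanishing (α : ℝ) (w : ℂ) (m : ℕ) : Submodule ℂ (ℂ → ℂ) where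
  carrier := {f | f ∈ space α ∧ ∀ k < m, iteratedDeriv k f w = 0}
  zero_mem' := ⟨(space α).zero_mem, fun k _ => by simp⟩
  add_mem' := by
    rintro f g ⟨hf, hf0⟩ ⟨hg, hg0⟩
    refine ⟨(space α).add_mem hf hg, fun k hk => ?_⟩
    rw [iteratedDeriv_add (hf.1.contDiff.contDiffAt) (hg.1.contDiff.contDiffAt),
      hf0 k hk, hg0 k hk, add_zero]
  smul_mem' := by
    rintro c f ⟨hf, hf0⟩
    refine ⟨(space α).smul_mem c hf, fun k hk => ?_⟩
    rw [iteratedDeriv_const_smul_field, hf0 k hk, smul_zero]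

/-- The quotient norm `‖f‖_{F^∞_α / N^∞_{w,m}} = inf {‖f - g‖_{α,∞} : g ∈ N^∞_{w,m}}`. -/
def quotNorm (α : ℝ) (w : ℂ) (m : ℕ) (f : ℂ → ℂ) : ℝ :=
  ⨅ g : vanishing α w m, supNorm α (f - (g : ℂ → ℂ))

/-- The divisor formed by the points `pt i` with multiplicities `m i` is sampling for `F^∞_α`:
`‖f‖_{α,∞} ≤ L sup_i ‖f‖_{F^∞_α / N^∞_{pt i, m i}}` for all `f ∈ F^∞_α`. The supremum is over
nonnegative numbers that are at most `‖f‖_{α,∞}`, and it is `0` for the empty divisor. -/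
def IsSampling {ι : Type*} (α : ℝ) (pt : ι → ℂ) (m : ι → ℕ) : Prop :=
  ∃ L : ℝ, 0 < L ∧ ∀ f ∈ space α, supNorm α f ≤ L * ⨆ i, quotNorm α (pt i) (m i) f

end Fock

end

open Filter Topology

noncomputable section

namespace Fock

/-! (a) Test on normalised kernels. If `z` lies at distance at least `√(m/α) + C` from `l`, the
order-`m` truncation of the kernel at `l` has norm at most `exp (-α C² / 2)` (`partial_exp_le`), and
so has the kernel in the quotient. If `z` escaped every enlarged disc, sampling would give `1 ≤ L
exp (-α C² / 2)`, which is false for large `C`.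

(b) A zero of order `m = α R²` at `w` forces smallness inside the disc of radius `R`: dividing it
out, the maximum principle gains a factor `exp (-α (R - dist z w)²)` over the bound on the circle
(`weightedAbs_mul_norm_le`). If sampling fails, take normalised `f n` whose quotient norms tend to
`0`. Off `K` each is close to a function with such a zero, so its weighted modulus is bounded away
from `1`, and its supremum is nearly attained on `K`. A locally uniform limit `F` has all the
prescribed zeros; once `F = 0`, this is a contradiction.

That `F = 0` is `eq_zero_of_isZeroDisc_cover`. If zero discs contain the origin arbitrarily deeply,
the gain kills `F` at every point. Otherwise the gain beats the slow growth of `‖z‖ ^ N`, so `F`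
decays faster than every power. The maximum principle with multiplier `ζ ^ N` then bounds `‖z‖ ^ N`
times the weighted modulus by `A r₀ ^ N`, and `N → ∞` gives zero outside radius `r₀`. -/

/-! ### Maximum principle on a disc centred at a multiple zero -/

lemma exists_eq_pow_mul_of_le_analyticOrderAt {w : ℂ} (m : ℕ) :
    ∀ {g : ℂ → ℂ}, Differentiable ℂ g → (m : ℕ∞) ≤ analyticOrderAt g w →
      ∃ k : ℂ → ℂ, Differentiable ℂ k ∧ ∀ z, g z = (z - w) ^ m * k z := by
  induction m with
  | zero => exact fun {g} hg _ => ⟨g, hg, fun z => by simp⟩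
  | succ m ih =>
    intro g hg hord
    have hg0 : g w = 0 := by
      refine (analyticOrderAt_ne_zero.1 fun h => ?_).2
      rw [h] at hord
      simp at hord
    have hd : Differentiable ℂ (dslope g w) := by
      rw [← differentiableOn_univ]
      exact (Complex.differentiableOn_dslope univ_mem).2 hg.differentiableOn
    have heq : g = (fun z => z - w) * dslope g w := by
      ext z
      simpa [hg0] using (sub_smul_dslope g w z).symm
    have hle : (m : ℕ∞) ≤ analyticOrderAt (dslope g w) w := by
      rw [heq, analyticOrderAt_mul (by fun_prop) (hd.analyticAt w),
        analyticOrderAt_id_sub_const_self, add_comm] at hord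
      push_cast at hord
      exact (ENat.add_le_add_iff_left ENat.one_ne_top).1 hord
    obtain ⟨k, hk, hk'⟩ := ih hd hle
    refine ⟨k, hk, fun z => ?_⟩
    have := congrFun heq z
    simp only [Pi.mul_apply] at this
    rw [this, hk', pow_succ]
    ring

lemma exists_eq_pow_mul {w : ℂ} {m : ℕ} {g : ℂ → ℂ} (hg : Differentiable ℂ g)
    (h : ∀ k < m, iteratedDeriv k g w = 0) :
    ∃ k : ℂ → ℂ, Differentiable ℂ k ∧ ∀ z, g z = (z - w) ^ m * k z :=
  exists_eq_pow_mul_of_le_analyticOrderAt m hg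
    ((natCast_le_analyticOrderAt_iff_iteratedDeriv_eq_zero (hg.analyticAt w)).2 h)

/-- The function `t ^ m * exp (-α t² / 2)` peaks at `t = R` exactly when `m = α R²`; this quantifies
the drop to the left of the peak. -/
lemma pow_le_pow_mul_exp {R ρ α : ℝ} {m : ℕ} (hR : 0 < R) (hρ : 0 ≤ ρ) (hρR : ρ ≤ R)
    (hα : 0 < α) (hm : (m : ℝ) = α * R ^ 2) :
    ρ ^ m ≤ R ^ m * Real.exp (-(α / 2) * (R ^ 2 - ρ ^ 2) - α * (R - ρ) ^ 2) := by
  -- This is `log (1 - u) ≤ -u - u² / 2`, used with `u = 1 - ρ / R`. The quadratic term improves the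
  -- final gain from `(α / 2) (R - ρ)²` to `α (R - ρ)²`.
  have hlog : ∀ u : ℝ, 0 ≤ u → u ≤ 1 → 1 - u ≤ Real.exp (-u - u ^ 2 / 2) := by
    intro u hu hu1
    have hmono : MonotoneOn (fun v : ℝ => Real.exp (-v - v ^ 2 / 2) - (1 - v)) (Icc 0 1) := by
      have hder : ∀ v : ℝ, HasDerivAt (fun v : ℝ => Real.exp (-v - v ^ 2 / 2) - (1 - v))
          (Real.exp (-v - v ^ 2 / 2) * (-1 - v) + 1) v := by
        intro v
        have h1 : HasDerivAt (fun v : ℝ => -v - v ^ 2 / 2) (-1 - v) v := by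
          have := ((hasDerivAt_id v).neg).sub (((hasDerivAt_id v).pow 2).div_const 2)
          convert! this using 1
          simp
        have := h1.exp.sub ((hasDerivAt_id v).const_sub 1)
        convert! this using 1
        simp
      refine monotoneOn_of_deriv_nonneg (convex_Icc 0 1)
        (fun v _ => (hder v).continuousAt.continuousWithinAt)
        (fun v _ => (hder v).differentiableAt.differentiableWithinAt) ?_
      intro v hv
      rw [interior_Icc] at hv
      rw [(hder v).deriv]
      have h2 : 1 + v ≤ Real.exp (v + v ^ 2 / 2) := by
        nlinarith [Real.add_one_le_exp (v + v ^ 2 / 2), sq_nonneg v]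
      have h3 : Real.exp (-v - v ^ 2 / 2) * Real.exp (v + v ^ 2 / 2) = 1 := by
        rw [← Real.exp_add]; ring_nf; simp
      nlinarith [Real.exp_pos (-v - v ^ 2 / 2)]
    have := hmono (left_mem_Icc.2 zero_le_one) ⟨hu, hu1⟩ hu
    simp at this
    linarith
  have h1 := hlog (1 - ρ / R) (by rw [sub_nonneg, div_le_one hR]; exact hρR)
    (by have := div_nonneg hρ hR.le; linarith)
  have h2 : ρ ≤ R * Real.exp (-(1 - ρ / R) - (1 - ρ / R) ^ 2 / 2) := by
    have : R * (1 - (1 - ρ / R)) ≤ R * Real.exp (-(1 - ρ / R) - (1 - ρ / R) ^ 2 / 2) :=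
      mul_le_mul_of_nonneg_left h1 hR.le
    rwa [show R * (1 - (1 - ρ / R)) = ρ by field_simp; ring] at this
  refine (pow_le_pow_left₀ hρ h2 m).trans_eq ?_
  rw [mul_pow, ← Real.exp_nat_mul, hm]
  congr 2
  field_simp
  ring

lemma weightedAbs_nonneg (α : ℝ) (f : ℂ → ℂ) (z : ℂ) : 0 ≤ weightedAbs α f z :=
  mul_nonneg (norm_nonneg _) (Real.exp_pos _).le

/-- Maximum principle for a function with a zero of order `α R²` at the centre of a disc of radius
`R`, with a holomorphic multiplier. -/
theorem weightedAbs_mul_norm_le {α R A : ℝ} {m : ℕ} {w z : ℂ} {g M : ℂ → ℂ} (hα : 0 < α)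
    (hR : 0 < R) (hm : (m : ℝ) = α * R ^ 2) (hg : Differentiable ℂ g)
    (hg0 : ∀ k < m, iteratedDeriv k g w = 0) (hM : DiffContOnCl ℂ M (ball w R))
    (hA : ∀ ζ ∈ sphere w R, weightedAbs α g ζ * ‖M ζ‖ ≤ A) (hz : z ∈ closedBall w R) :
    weightedAbs α g z * ‖M z‖ ≤ A * Real.exp (-α * (R - dist z w) ^ 2) := by
  obtain ⟨k, hk, hgk⟩ := exists_eq_pow_mul hg hg0
  have hsq : ∀ ζ : ℂ, ‖ζ‖ ^ 2 = ‖w‖ ^ 2 + 2 * (star w * (ζ - w)).re + ‖ζ - w‖ ^ 2 := by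
    intro ζ
    simp only [Complex.sq_norm, Complex.normSq_apply, Complex.star_def, Complex.mul_re,
      Complex.conj_re, Complex.conj_im, Complex.sub_re, Complex.sub_im]
    ring
  -- The exponential absorbs the cross term of the Gaussian weight, moving `w` to the origin; what
  -- is left of the weight is radial about `w`.
  let G : ℂ → ℂ := fun ζ => k ζ * Complex.exp (-(α : ℂ) * (star w * (ζ - w))) * M ζ
  have hGd : DiffContOnCl ℂ G (ball w R) := by
    have h1 : Differentiable ℂ
        (fun ζ => k ζ * Complex.exp (-(α : ℂ) * (star w * (ζ - w)))) := by fun_prop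
    exact h1.diffContOnCl.smul hM
  have hkey : ∀ ζ : ℂ, weightedAbs α g ζ * ‖M ζ‖ =
      ‖ζ - w‖ ^ m * Real.exp (-(α / 2) * (‖w‖ ^ 2 + ‖ζ - w‖ ^ 2)) * ‖G ζ‖ := by
    intro ζ
    have h1 : ‖Complex.exp (-(α : ℂ) * (star w * (ζ - w)))‖ =
        Real.exp (-α * (star w * (ζ - w)).re) := by
      rw [Complex.norm_exp, ← Complex.ofReal_neg, Complex.re_ofReal_mul]
    simp only [weightedAbs, G, norm_mul, h1, hgk ζ, norm_pow, hsq ζ]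
    rw [show -(α / 2) * (‖w‖ ^ 2 + 2 * (star w * (ζ - w)).re + ‖ζ - w‖ ^ 2) =
      -(α / 2) * (‖w‖ ^ 2 + ‖ζ - w‖ ^ 2) + -α * (star w * (ζ - w)).re by ring, Real.exp_add]
    ring
  set E : ℝ := R ^ m * Real.exp (-(α / 2) * (‖w‖ ^ 2 + R ^ 2)) with hE
  have hEpos : 0 < E := by positivity
  have hGz : ‖G z‖ ≤ A / E := by
    refine Complex.norm_le_of_forall_mem_frontier_norm_le isBounded_ball hGd (fun ζ hζ => ?_)
      (by rwa [closure_ball w hR.ne'])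
    rw [frontier_ball w hR.ne'] at hζ
    have h1 := hA ζ hζ
    rw [hkey, mem_sphere_iff_norm.1 hζ] at h1
    rwa [le_div_iff₀ hEpos, mul_comm]
  have hρ : ‖z - w‖ ≤ R := by simpa [dist_eq_norm] using hz
  have hpow := pow_le_pow_mul_exp hR (norm_nonneg (z - w)) hρ hα hm
  rw [hkey, dist_eq_norm]
  calc ‖z - w‖ ^ m * Real.exp (-(α / 2) * (‖w‖ ^ 2 + ‖z - w‖ ^ 2)) * ‖G z‖
      ≤ (R ^ m * Real.exp (-(α / 2) * (R ^ 2 - ‖z - w‖ ^ 2) - α * (R - ‖z - w‖) ^ 2)) *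
        Real.exp (-(α / 2) * (‖w‖ ^ 2 + ‖z - w‖ ^ 2)) * (A / E) := by gcongr
    _ = E * Real.exp (-α * (R - ‖z - w‖) ^ 2) * (A / E) := by
        congr 1
        rw [hE, mul_assoc, mul_assoc, ← Real.exp_add, ← Real.exp_add]
        congr 2
        ring
    _ = A * Real.exp (-α * (R - ‖z - w‖) ^ 2) := by field_simp

/-! ### Sup norm and quotient norm -/

lemma weightedAbs_le_supNorm {α : ℝ} {f : ℂ → ℂ} (hf : f ∈ space α) (z : ℂ) :
    weightedAbs α f z ≤ supNorm α f :=
  le_ciSup hf.2 z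

lemma supNorm_nonneg (α : ℝ) (f : ℂ → ℂ) : 0 ≤ supNorm α f :=
  Real.iSup_nonneg fun z => weightedAbs_nonneg α f z

lemma supNorm_le {α A : ℝ} {f : ℂ → ℂ} (h : ∀ z, weightedAbs α f z ≤ A) : supNorm α f ≤ A :=
  ciSup_le h

lemma weightedAbs_add_le (α : ℝ) (f g : ℂ → ℂ) (z : ℂ) :
    weightedAbs α (f + g) z ≤ weightedAbs α f z + weightedAbs α g z := by
  unfold weightedAbs
  rw [← add_mul]
  exact mul_le_mul_of_nonneg_right (norm_add_le _ _) (Real.exp_pos _).le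

lemma weightedAbs_sub_comm (α : ℝ) (f g : ℂ → ℂ) (z : ℂ) :
    weightedAbs α (f - g) z = weightedAbs α (g - f) z := by
  simp [weightedAbs, norm_sub_rev]

lemma weightedAbs_smul (α : ℝ) (c : ℂ) (f : ℂ → ℂ) (z : ℂ) :
    weightedAbs α (c • f) z = ‖c‖ * weightedAbs α f z := by
  simp [weightedAbs, mul_assoc]

lemma bddBelow_range_supNorm_sub (α : ℝ) (w : ℂ) (m : ℕ) (f : ℂ → ℂ) :
    BddBelow (range fun g : vanishing α w m => supNorm α (f - (g : ℂ → ℂ))) :=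
  ⟨0, by rintro _ ⟨g, rfl⟩; exact supNorm_nonneg _ _⟩

lemma quotNorm_le_supNorm_sub {α : ℝ} {w : ℂ} {m : ℕ} {f g : ℂ → ℂ} (hg : g ∈ vanishing α w m) :
    quotNorm α w m f ≤ supNorm α (f - g) :=
  ciInf_le (bddBelow_range_supNorm_sub α w m f) ⟨g, hg⟩

lemma quotNorm_nonneg (α : ℝ) (w : ℂ) (m : ℕ) (f : ℂ → ℂ) : 0 ≤ quotNorm α w m f :=
  le_ciInf fun _ => supNorm_nonneg _ _

lemma quotNorm_le_supNorm (α : ℝ) (w : ℂ) (m : ℕ) (f : ℂ → ℂ) :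
    quotNorm α w m f ≤ supNorm α f := by
  simpa using quotNorm_le_supNorm_sub (f := f) (vanishing α w m).zero_mem

/-! ### Part (a): truncated kernels as test functions -/

/-- The normalised reproducing kernel at `z`. -/
def kernel (α : ℝ) (z : ℂ) : ℂ → ℂ :=
  fun w => Complex.exp (α * star z * w - (α / 2 * ‖z‖ ^ 2 : ℝ))

lemma weightedAbs_kernel (α : ℝ) (z w : ℂ) :
    weightedAbs α (kernel α z) w = Real.exp (-(α / 2) * ‖w - z‖ ^ 2) := by
  rw [weightedAbs, kernel, Complex.norm_exp, ← Real.exp_add]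
  congr 1
  simp only [Complex.sq_norm, Complex.normSq_apply, Complex.star_def, Complex.mul_re,
    Complex.mul_im, Complex.conj_re, Complex.conj_im, Complex.sub_re, Complex.sub_im,
    Complex.ofReal_re, Complex.ofReal_im]
  ring

lemma kernel_mem_space {α : ℝ} (hα : 0 < α) (z : ℂ) : kernel α z ∈ space α := by
  refine ⟨by unfold kernel; fun_prop, 1, ?_⟩
  rintro _ ⟨w, rfl⟩
  rw [weightedAbs_kernel, Real.exp_le_one_iff]
  nlinarith [sq_nonneg ‖w - z‖]

lemma one_le_supNorm_kernel {α : ℝ} (hα : 0 < α) (z : ℂ) : 1 ≤ supNorm α (kernel α z) := by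
  simpa [weightedAbs_kernel] using weightedAbs_le_supNorm (kernel_mem_space hα z) z

/-- The part of the kernel at `z` given by the Taylor polynomial of degree `< m` at `l`, after
translation of `l` to the origin. -/
def kernelTaylor (α : ℝ) (z l : ℂ) (m : ℕ) : ℂ → ℂ :=
  fun w => kernel α z l * Complex.exp (α * star l * (w - l)) *
    ∑ k ∈ Finset.range m, (α * star (z - l) * (w - l)) ^ k / (k.factorial : ℂ)

lemma weightedAbs_kernelTaylor_le {α : ℝ} (hα : 0 < α) (z l w : ℂ) (m : ℕ) :
    weightedAbs α (kernelTaylor α z l m) w ≤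
      Real.exp (-(α / 2) * (‖z - l‖ ^ 2 + ‖w - l‖ ^ 2)) *
        ∑ k ∈ Finset.range m, (α * ‖z - l‖ * ‖w - l‖) ^ k / (k.factorial : ℝ) := by
  have h1 : ‖kernel α z l‖ * ‖Complex.exp (α * star l * (w - l))‖ *
      Real.exp (-(α / 2) * ‖w‖ ^ 2) = Real.exp (-(α / 2) * (‖z - l‖ ^ 2 + ‖w - l‖ ^ 2)) := by
    rw [kernel, Complex.norm_exp, Complex.norm_exp, ← Real.exp_add, ← Real.exp_add]
    congr 1
    simp only [Complex.sq_norm, Complex.normSq_apply, Complex.star_def, Complex.mul_re,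
      Complex.mul_im, Complex.conj_re, Complex.conj_im, Complex.sub_re, Complex.sub_im,
      Complex.ofReal_re, Complex.ofReal_im]
    ring
  have h2 : ‖∑ k ∈ Finset.range m, (α * star (z - l) * (w - l)) ^ k / (k.factorial : ℂ)‖ ≤
      ∑ k ∈ Finset.range m, (α * ‖z - l‖ * ‖w - l‖) ^ k / (k.factorial : ℝ) := by
    refine (norm_sum_le _ _).trans_eq (Finset.sum_congr rfl fun k _ => ?_)
    rw [norm_div, norm_pow, norm_mul, norm_mul, norm_star, Complex.norm_real,
      Real.norm_of_nonneg hα.le, Complex.norm_natCast]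
  rw [weightedAbs, kernelTaylor, norm_mul, norm_mul, mul_right_comm, h1]
  exact mul_le_mul_of_nonneg_left h2 (Real.exp_pos _).le

/-- Scaling `x` down to `R` costs `(x / R) ^ m ≤ exp (α R (x - R))`, and the scaled sum is at most
`exp (α R y)`. The total exponent is `-(α / 2) ((x - R)² + (y - R)²)`. -/
lemma partial_exp_le {α x y R : ℝ} {m : ℕ} (hα : 0 < α) (hx : 0 < x) (hy : 0 ≤ y) (hR : 0 ≤ R)
    (hRx : R ≤ x) (hm : (m : ℝ) = α * R ^ 2) :
    Real.exp (-(α / 2) * (x ^ 2 + y ^ 2)) *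
        ∑ k ∈ Finset.range m, (α * x * y) ^ k / (k.factorial : ℝ) ≤
      Real.exp (-(α / 2) * (x - R) ^ 2) := by
  rcases hR.eq_or_lt with rfl | hR
  · have : m = 0 := by simpa using hm
    subst this
    simpa using (Real.exp_pos _).le
  set θ := R / x
  have hθ : 0 < θ := by positivity
  have hθ1 : θ ≤ 1 := (div_le_one hx).2 hRx
  have h1 : θ ^ m * ∑ k ∈ Finset.range m, (α * x * y) ^ k / (k.factorial : ℝ) ≤
      Real.exp (α * R * y) := by
    calc θ ^ m * ∑ k ∈ Finset.range m, (α * x * y) ^ k / (k.factorial : ℝ)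
        ≤ ∑ k ∈ Finset.range m, (α * R * y) ^ k / (k.factorial : ℝ) := by
          rw [Finset.mul_sum]
          refine Finset.sum_le_sum fun k hk => ?_
          have h3 : (α * R * y) ^ k = θ ^ k * (α * x * y) ^ k := by
            rw [← mul_pow]; congr 1; simp only [θ]; field_simp
          rw [h3, mul_div_assoc]
          exact mul_le_mul_of_nonneg_right
            (pow_le_pow_of_le_one hθ.le hθ1 (Finset.mem_range.1 hk).le) (by positivity)
      _ ≤ _ := Real.sum_le_exp_of_nonneg (by positivity) m
  have h2 : (1 / θ) ^ m ≤ Real.exp (α * R * (x - R)) := by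
    have h4 : 1 / θ ≤ Real.exp (x / R - 1) := by
      have := Real.add_one_le_exp (x / R - 1)
      simpa [θ] using this
    refine (pow_le_pow_left₀ (by positivity) h4 m).trans_eq ?_
    rw [← Real.exp_nat_mul, hm]
    congr 1
    field_simp
  calc Real.exp (-(α / 2) * (x ^ 2 + y ^ 2)) *
        ∑ k ∈ Finset.range m, (α * x * y) ^ k / (k.factorial : ℝ)
      = Real.exp (-(α / 2) * (x ^ 2 + y ^ 2)) * ((1 / θ) ^ m *
        (θ ^ m * ∑ k ∈ Finset.range m, (α * x * y) ^ k / (k.factorial : ℝ))) := by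
        rw [← mul_assoc ((1 / θ) ^ m), ← mul_pow, one_div_mul_cancel hθ.ne', one_pow, one_mul]
    _ ≤ Real.exp (-(α / 2) * (x ^ 2 + y ^ 2)) *
        (Real.exp (α * R * (x - R)) * Real.exp (α * R * y)) := by gcongr
    _ ≤ Real.exp (-(α / 2) * (x - R) ^ 2) := by
        rw [← Real.exp_add, ← Real.exp_add, Real.exp_le_exp]
        nlinarith [mul_nonneg hα.le (sq_nonneg (y - R))]

/-- The kernel is `kernel α z l` times `exp (α * star l * (w - l))` times `exp (α * star (z - l) *
(w - l))`. Only the last factor is truncated, so the difference is a Taylor remainder of the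
exponential. -/
lemma kernel_sub_kernelTaylor_order {α : ℝ} (z l : ℂ) (m : ℕ) :
    (m : ℕ∞) ≤ analyticOrderAt (kernel α z - kernelTaylor α z l m) l := by
  have hd : Differentiable ℂ (kernel α z - kernelTaylor α z l m) := by
    unfold kernel kernelTaylor
    fun_prop
  obtain ⟨F, hF, hFe⟩ :=
    AnalyticAt.exists_eq_sum_add_pow_mul (f := Complex.exp) (by fun_prop) m
  rw [natCast_le_analyticOrderAt (hd.analyticAt l)]
  refine ⟨fun w => kernel α z l * Complex.exp (α * star l * (w - l)) *
    ((α * star (z - l)) ^ m * F (α * star (z - l) * (w - l))), ?_, Eventually.of_forall fun w => ?_⟩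
  · have h1 : AnalyticAt ℂ (fun w : ℂ => (α : ℂ) * star (z - l) * (w - l)) l := by fun_prop
    have h2 : AnalyticAt ℂ (fun w : ℂ => F (α * star (z - l) * (w - l))) l := by
      refine AnalyticAt.fun_comp ?_ h1
      simpa using hF
    exact (by fun_prop : AnalyticAt ℂ
      (fun w : ℂ => kernel α z l * Complex.exp (α * star l * (w - l))) l).mul
        (analyticAt_const.mul h2)
  · have h3 : kernel α z w = kernel α z l * Complex.exp (α * star l * (w - l)) *
        Complex.exp (α * star (z - l) * (w - l)) := by
      simp only [kernel, ← Complex.exp_add]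
      congr 1
      rw [star_sub]
      ring
    have h4 := hFe (α * star (z - l) * (w - l))
    simp only [iteratedDeriv_eq_iterate, Complex.iter_deriv_exp, smul_eq_mul,
      Complex.exp_zero, mul_one] at h4
    simp only [Pi.sub_apply, smul_eq_mul]
    rw [h3, h4, kernelTaylor, mul_pow ((α : ℂ) * star (z - l)) (w - l) m]
    ring

lemma quotNorm_kernel_le {α C : ℝ} (hα : 0 < α) (hC : 0 < C) {z l : ℂ} {m : ℕ}
    (h : Real.sqrt (m / α) + C ≤ dist z l) :
    quotNorm α l m (kernel α z) ≤ Real.exp (-(α / 2) * C ^ 2) := by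
  have hR := Real.sqrt_nonneg (m / α)
  have hm : (m : ℝ) = α * Real.sqrt (m / α) ^ 2 := by
    rw [Real.sq_sqrt (by positivity)]; field_simp
  rw [dist_eq_norm] at h
  have hP : ∀ w, weightedAbs α (kernelTaylor α z l m) w ≤ Real.exp (-(α / 2) * C ^ 2) := by
    intro w
    refine (weightedAbs_kernelTaylor_le hα z l w m).trans
      ((partial_exp_le hα (by linarith) (norm_nonneg _) hR (by linarith) hm).trans ?_)
    rw [Real.exp_le_exp]
    have : C ^ 2 ≤ (‖z - l‖ - Real.sqrt (m / α)) ^ 2 := by gcongr; linarith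
    nlinarith
  have hPs : kernelTaylor α z l m ∈ space α := by
    refine ⟨by unfold kernelTaylor; fun_prop, Real.exp (-(α / 2) * C ^ 2), ?_⟩
    rintro _ ⟨w, rfl⟩
    exact hP w
  have hsub := (space α).sub_mem (kernel_mem_space hα z) hPs
  have hmem : kernel α z - kernelTaylor α z l m ∈ vanishing α l m :=
    ⟨hsub, (natCast_le_analyticOrderAt_iff_iteratedDeriv_eq_zero (hsub.1.analyticAt l)).1
      (kernel_sub_kernelTaylor_order z l m)⟩
  refine (quotNorm_le_supNorm_sub hmem).trans ?_
  rw [sub_sub_cancel]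
  exact supNorm_le hP

theorem IsSampling.exists_iUnion_ball_eq_univ {ι : Type*} {α : ℝ} (hα : 0 < α) {pt : ι → ℂ}
    {m : ι → ℕ} (h : IsSampling α pt m) :
    ∃ C : ℝ, 0 < C ∧ ⋃ i, ball (pt i) (Real.sqrt (m i / α) + C) = univ := by
  obtain ⟨L, hL, hs⟩ := h
  have htend : Tendsto (fun C : ℝ => L * Real.exp (-(α / 2) * C ^ 2)) atTop (𝓝 (L * 0)) := by
    refine Tendsto.const_mul L (Real.tendsto_exp_atBot.comp ?_)
    exact (tendsto_pow_atTop two_ne_zero).const_mul_atTop_of_neg (by linarith)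
  rw [mul_zero] at htend
  obtain ⟨C, hC1, hC⟩ :=
    ((htend.eventually_lt_const one_pos).and (eventually_gt_atTop 0)).exists
  refine ⟨C, hC, eq_univ_of_forall fun z => ?_⟩
  by_contra hz
  simp only [mem_iUnion, mem_ball, not_exists, not_lt] at hz
  -- Nonnegativity of the bound takes care of the empty divisor, whose supremum is `0`.
  have h1 : ⨆ i, quotNorm α (pt i) (m i) (kernel α z) ≤ Real.exp (-(α / 2) * C ^ 2) :=
    Real.iSup_le (fun i => quotNorm_kernel_le hα hC (hz i)) (Real.exp_pos _).le
  have h2 := hs _ (kernel_mem_space hα z)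
  have h3 := one_le_supNorm_kernel hα z
  have h4 := mul_le_mul_of_nonneg_left h1 hL.le
  linarith

/-! ### Part (b): zero discs and contraction -/

/-- The disc of centre `w` and radius `R` whose radius is determined by a zero of `f` at `w`. -/
def IsZeroDisc (α : ℝ) (f : ℂ → ℂ) (w : ℂ) (R : ℝ) : Prop :=
  0 < R ∧ ∃ m : ℕ, (m : ℝ) = α * R ^ 2 ∧ ∀ k < m, iteratedDeriv k f w = 0

lemma IsZeroDisc.weightedAbs_mul_norm_le {α R A : ℝ} {w z : ℂ} {f M : ℂ → ℂ} (hα : 0 < α)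
    (hf : Differentiable ℂ f) (hd : IsZeroDisc α f w R) (hM : DiffContOnCl ℂ M (ball w R))
    (hA : ∀ ζ ∈ sphere w R, weightedAbs α f ζ * ‖M ζ‖ ≤ A) (hz : z ∈ closedBall w R) :
    weightedAbs α f z * ‖M z‖ ≤ A * Real.exp (-α * (R - dist z w) ^ 2) := by
  obtain ⟨hR, m, hm, h0⟩ := hd
  exact Fock.weightedAbs_mul_norm_le hα hR hm hf h0 hM hA hz

lemma IsZeroDisc.weightedAbs_le {α R A : ℝ} {w z : ℂ} {f : ℂ → ℂ} (hα : 0 < α)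
    (hf : Differentiable ℂ f) (hd : IsZeroDisc α f w R)
    (hA : ∀ ζ, weightedAbs α f ζ ≤ A) (hz : z ∈ closedBall w R) :
    weightedAbs α f z ≤ A * Real.exp (-α * (R - dist z w) ^ 2) := by
  simpa using hd.weightedAbs_mul_norm_le (M := fun _ => 1) hα hf diffContOnCl_const
    (fun ζ _ => by simpa using hA ζ) hz

lemma exp_neg_mul_sq_le {α C d : ℝ} (hα : 0 < α) (hC : 0 ≤ C) (h : C ≤ d) :
    Real.exp (-α * d ^ 2) ≤ Real.exp (-α * C ^ 2) := by
  rw [Real.exp_le_exp]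
  have : C ^ 2 ≤ d ^ 2 := by gcongr
  nlinarith

lemma exp_neg_mul_sq_lt_one {α C : ℝ} (hα : 0 < α) (hC : 0 < C) : Real.exp (-α * C ^ 2) < 1 := by
  rw [Real.exp_lt_one_iff, neg_mul, neg_lt_zero]
  positivity

/-- A bounded function that contracts its own upper bounds, up to the constant `Q`, is at most
`Q`. -/
lemma le_of_forall_le_max {X : Type*} {u : X → ℝ} {Q q : ℝ} (hb : BddAbove (range u))
    (hQ : 0 ≤ Q) (hq : q < 1)
    (h : ∀ U, (∀ x, u x ≤ U) → ∀ x, u x ≤ max Q (q * U)) (x : X) : u x ≤ Q := by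
  have : Nonempty X := ⟨x⟩
  have h1 : ⨆ x, u x ≤ max Q (q * ⨆ x, u x) := ciSup_le (h _ (le_ciSup hb))
  refine (le_ciSup hb x).trans ?_
  by_contra! hlt
  rcases le_max_iff.1 h1 with h2 | h2
  · linarith
  · nlinarith

/-- The derivative `2 log t / t` of `log² t` is bounded on `[1, ∞)`, so a shift of bounded length
changes `log²` by a bounded amount. -/
lemma log_sq_sub_log_sq_le {q s r : ℝ} (hq : 1 ≤ q) (hs : s ≤ q + 2 * r) (hqs : q ≤ s) :
    Real.log s - Real.log q ≤ 2 * r / q ∧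
      Real.log s ^ 2 - Real.log q ^ 2 ≤ 4 * r * (1 + r) := by
  have hq0 : 0 < q := by linarith
  have hs0 : 0 < s := by linarith
  have hr : 0 ≤ r := by linarith
  have h1 : Real.log s - Real.log q ≤ 2 * r / q := by
    rw [← Real.log_div (by linarith) hq0.ne']
    refine (Real.log_le_sub_one_of_pos (by positivity)).trans ?_
    rw [div_sub_one hq0.ne']
    gcongr
    linarith
  refine ⟨h1, ?_⟩
  have hσ : 0 ≤ Real.log q := Real.log_nonneg hq
  have hσq : Real.log q ≤ q := (Real.log_le_sub_one_of_pos hq0).trans (by linarith)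
  have hτσ : Real.log q ≤ Real.log s := Real.log_le_log hq0 hqs
  have h2 : 2 * r / q ≤ 2 * r := div_le_self (by linarith) hq
  have h3 : 2 * r / q * Real.log q ≤ 2 * r := by
    rw [div_mul_eq_mul_div, div_le_iff₀ hq0]
    gcongr
  calc Real.log s ^ 2 - Real.log q ^ 2
      = (Real.log s - Real.log q) * (Real.log s + Real.log q) := by ring
    _ ≤ 2 * r / q * (2 * Real.log q + 2 * r) := by
        exact mul_le_mul h1 (by linarith) (by linarith) (by positivity)
    _ = 2 * (2 * r / q * Real.log q) + 2 * r / q * (2 * r) := by ring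
    _ ≤ 2 * (2 * r) + 2 * r * (2 * r) := by gcongr
    _ = 4 * r * (1 + r) := by ring

/-! ### Slowly growing multipliers and rapid decay -/

/-- A slowly varying weight comparable with `(‖z‖ + r) ^ N`, but bounded. -/
def slowWeight (N δ r : ℝ) (z : ℂ) : ℝ :=
  Real.exp (N * Real.log (‖z‖ + r) - δ * Real.log (‖z‖ + r) ^ 2)

lemma slowWeight_le {N δ r : ℝ} (hδ : 0 < δ) (z : ℂ) :
    slowWeight N δ r z ≤ Real.exp (N ^ 2 / (4 * δ)) := by
  rw [slowWeight, Real.exp_le_exp, le_div_iff₀ (by positivity)]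
  nlinarith [sq_nonneg (N - 2 * δ * Real.log (‖z‖ + r))]

/-- In a disc that does not contain the origin deep inside, `slowWeight` is nearly the modulus of
a holomorphic function. -/
lemma exists_multiplier {w : ℂ} {R B N δ : ℝ} (hR : 0 < R) (hB : 0 ≤ B) (hRB : R ≤ ‖w‖ + B)
    (hN : 0 ≤ N) (hδ : 0 ≤ δ) :
    ∃ M : ℂ → ℂ, DiffContOnCl ℂ M (ball w R) ∧
      (∀ ζ ∈ closedBall w R, ‖M ζ‖ ≤ slowWeight N δ (B + 1) ζ *
        Real.exp (δ * (4 * (B + 1) * (1 + (B + 1)) + (Real.pi / 2) ^ 2))) ∧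
      ∀ ζ ∈ closedBall w R, B + 1 < ‖ζ‖ → slowWeight N δ (B + 1) ζ *
        Real.exp (-(N * (2 * (B + 1)) / (‖ζ‖ - (B + 1)))) ≤ ‖M ζ‖ := by
  obtain ⟨e, he, hwe⟩ : ∃ e : ℂ, ‖e‖ = 1 ∧ w = ‖w‖ * e := by
    rcases eq_or_ne w 0 with rfl | hw
    · exact ⟨1, by simp, by simp⟩
    · have : ‖w‖ ≠ 0 := norm_ne_zero_iff.2 hw
      have hc : (‖w‖ : ℂ) ≠ 0 := Complex.ofReal_ne_zero.2 this
      refine ⟨w / ‖w‖, by simp [this], ?_⟩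
      field_simp
  set r := B + 1 with hr
  -- Rotate `w` onto the nonnegative real axis and shift by `r`. As `R ≤ ‖w‖ + B`, the disc lands in
  -- `Re ≥ 1`, where the principal logarithm is holomorphic and its argument is at most `π / 2` in
  -- modulus.
  let p : ℂ → ℂ := fun ζ => star e * ζ + r
  have hee : star e * e = 1 := by
    rw [Complex.star_def, mul_comm, Complex.mul_conj, Complex.normSq_eq_norm_sq, he]
    simp
  have hre : ∀ ζ ∈ closedBall w R, 1 ≤ (p ζ).re := by
    intro ζ hζ
    have h1 : p ζ = star e * (ζ - w) + ((‖w‖ + r : ℝ) : ℂ) := by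
      have : star e * w = ‖w‖ := by
        rw [hwe]
        simp only [norm_mul, he, Complex.norm_real, norm_norm, mul_one]
        rw [mul_left_comm, hee, mul_one]
      simp only [p]
      rw [mul_sub, this]
      push_cast
      ring
    have h2 : ‖star e * (ζ - w)‖ ≤ R := by
      rw [norm_mul, norm_star, he, one_mul]
      simpa [dist_eq_norm] using hζ
    have h3 := (abs_le.1 ((Complex.abs_re_le_norm _).trans h2)).1
    rw [h1, Complex.add_re, Complex.ofReal_re]
    linarith
  have hnorm : ∀ ζ ∈ closedBall w R, ‖Complex.exp (N * Complex.log (p ζ) -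
      δ * Complex.log (p ζ) ^ 2)‖ = Real.exp (N * Real.log ‖p ζ‖ - δ * Real.log ‖p ζ‖ ^ 2 +
        δ * (p ζ).arg ^ 2) := by
    intro ζ _
    rw [Complex.norm_exp]
    congr 1
    simp only [Complex.sub_re, sq, Complex.mul_re, Complex.log_re,
      Complex.log_im, Complex.ofReal_re, Complex.ofReal_im]
    ring
  have hstar : ∀ ζ : ℂ, ‖star e * ζ‖ = ‖ζ‖ := fun ζ => by rw [norm_mul, norm_star, he, one_mul]
  have hrn : ‖(r : ℂ)‖ = r := by
    rw [Complex.norm_real, Real.norm_of_nonneg (by linarith)]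
  have hle : ∀ ζ, ‖p ζ‖ ≤ ‖ζ‖ + r := fun ζ =>
    (norm_add_le _ _).trans_eq (by rw [hstar, hrn])
  have hge : ∀ ζ, ‖ζ‖ - r ≤ ‖p ζ‖ := fun ζ => by
    have := norm_sub_le_norm_add (star e * ζ) (r : ℂ)
    rwa [hstar, hrn] at this
  have hone : ∀ ζ ∈ closedBall w R, 1 ≤ ‖p ζ‖ := fun ζ hζ =>
    (hre ζ hζ).trans (Complex.re_le_norm _)
  have hlog := fun ζ (hζ : ζ ∈ closedBall w R) =>
    log_sq_sub_log_sq_le (r := r) (hone ζ hζ) (by linarith [hge ζ]) (hle ζ)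
  refine ⟨fun ζ => Complex.exp (N * Complex.log (p ζ) - δ * Complex.log (p ζ) ^ 2), ?_, ?_, ?_⟩
  · refine DifferentiableOn.diffContOnCl fun ζ hζ => ?_
    rw [closure_ball w hR.ne'] at hζ
    have hs : p ζ ∈ Complex.slitPlane := Or.inl (by linarith [hre ζ hζ])
    have hp : DifferentiableAt ℂ p ζ := by fun_prop
    have hl : DifferentiableAt ℂ (fun ζ => Complex.log (p ζ)) ζ := hp.clog hs
    exact DifferentiableAt.differentiableWithinAt (by fun_prop)
  · intro ζ hζ
    rw [hnorm ζ hζ, slowWeight, ← Real.exp_add, Real.exp_le_exp]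
    have h1 : (p ζ).arg ^ 2 ≤ (Real.pi / 2) ^ 2 := by
      rw [← sq_abs]
      gcongr
      exact Complex.abs_arg_le_pi_div_two_iff.2 (by linarith [hre ζ hζ])
    have h2 : Real.log ‖p ζ‖ ≤ Real.log (‖ζ‖ + r) :=
      Real.log_le_log (by linarith [hone ζ hζ]) (hle ζ)
    have h3 := mul_le_mul_of_nonneg_left (hlog ζ hζ).2 hδ
    have h4 := mul_le_mul_of_nonneg_left h1 hδ
    have h5 := mul_le_mul_of_nonneg_left h2 hN
    linarith
  · intro ζ hζ hζr
    rw [hnorm ζ hζ, slowWeight, ← Real.exp_add, Real.exp_le_exp]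
    have h0 : 0 < ‖ζ‖ - r := by linarith
    have h1 : Real.log (‖ζ‖ + r) - Real.log ‖p ζ‖ ≤ 2 * r / (‖ζ‖ - r) := by
      refine (hlog ζ hζ).1.trans ?_
      gcongr
      exact hge ζ
    have h2 : Real.log ‖p ζ‖ ^ 2 ≤ Real.log (‖ζ‖ + r) ^ 2 := by
      have := Real.log_nonneg (hone ζ hζ)
      have := Real.log_le_log (by linarith [hone ζ hζ]) (hle ζ)
      gcongr
    have h3 := mul_le_mul_of_nonneg_left h2 hδ
    have h4 := mul_le_mul_of_nonneg_left h1 hN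
    have h5 := mul_nonneg hδ (sq_nonneg (p ζ).arg)
    rw [mul_div_assoc]
    linarith

/-- Rapid decay of a function with many zeros near infinity. -/
lemma exists_weightedAbs_mul_pow_le {α C B r₀ A : ℝ} {f : ℂ → ℂ} (hα : 0 < α) (hC : 0 < C)
    (hB : 0 ≤ B) (hf : Differentiable ℂ f) (hA : ∀ z, weightedAbs α f z ≤ A)
    (hcov : ∀ z : ℂ, r₀ < ‖z‖ → ∃ w R, IsZeroDisc α f w R ∧ dist z w < R - C)
    (hRB : ∀ w R, IsZeroDisc α f w R → R ≤ ‖w‖ + B) (N : ℕ) :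
    ∃ Q, ∀ z, weightedAbs α f z * ‖z‖ ^ N ≤ Q := by
  have hA0 : 0 ≤ A := (weightedAbs_nonneg α f 0).trans (hA 0)
  set r := B + 1 with hr
  have hr0 : 0 < r := by linarith
  set D := 4 * r * (1 + r) + (Real.pi / 2) ^ 2 with hD
  have hD0 : 0 < D := by positivity
  have hc : 0 < α * C ^ 2 := by positivity
  have htend : Tendsto (fun x : ℝ => N * (2 * r) / (x - r)) atTop (𝓝 0) :=
    Tendsto.const_div_atTop (tendsto_atTop_add_const_right _ _ tendsto_id) _
  -- Of the gain `α C²`, a quarter pays for `δ * D` and a quarter for the lower bound on the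
  -- multiplier; half remains as contraction.
  obtain ⟨r₂, hr₂⟩ := eventually_atTop.1 (((htend.eventually_lt_const
    (show (0 : ℝ) < α * C ^ 2 / 4 by positivity)).and
    (eventually_gt_atTop r)).and (eventually_gt_atTop r₀))
  have hr₂r : r < r₂ := (hr₂ r₂ le_rfl).1.2
  have hr₂0 : 0 < r₂ := hr0.trans hr₂r
  refine ⟨A * (r₂ + r) ^ N, fun z => ?_⟩
  -- The `δ` term makes the weighted function bounded a priori, as the contraction argument
  -- requires. The resulting bound and `r₂` do not depend on `δ`, so `δ → 0` is allowed.
  have hmain : ∀ δ : ℝ, 0 < δ → δ * D ≤ α * C ^ 2 / 4 → ∀ z,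
      weightedAbs α f z * slowWeight N δ r z ≤ A * (r₂ + r) ^ N := by
    intro δ hδ hδD
    refine le_of_forall_le_max (q := Real.exp (-(α * C ^ 2 / 2)))
      ⟨A * Real.exp ((N : ℝ) ^ 2 / (4 * δ)), ?_⟩ (by positivity)
      (Real.exp_lt_one_iff.2 (by linarith)) ?_
    · rintro _ ⟨z, rfl⟩
      exact mul_le_mul (hA z) (slowWeight_le hδ z) (Real.exp_pos _).le hA0
    intro U hU z
    rcases le_or_gt ‖z‖ r₂ with hz | hz
    · refine le_max_of_le_left (mul_le_mul (hA z) ?_ (Real.exp_pos _).le hA0)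
      have hpos : 0 < ‖z‖ + r := by linarith [norm_nonneg z]
      calc slowWeight N δ r z ≤ Real.exp (N * Real.log (‖z‖ + r)) := by
            rw [slowWeight, Real.exp_le_exp]
            nlinarith [sq_nonneg (Real.log (‖z‖ + r))]
        _ = (‖z‖ + r) ^ N := by rw [Real.exp_nat_mul, Real.exp_log hpos]
        _ ≤ (r₂ + r) ^ N := by gcongr
    · refine le_max_of_le_right ?_
      obtain ⟨⟨hz1, hzr⟩, hz0⟩ := hr₂ ‖z‖ hz.le
      obtain ⟨w, R, hd, hzw⟩ := hcov z hz0
      have hzR : z ∈ closedBall w R := by rw [mem_closedBall]; linarith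
      obtain ⟨M, hM, hMle, hMge⟩ := exists_multiplier (N := N) (δ := δ) hd.1 hB (hRB w R hd)
        N.cast_nonneg hδ.le
      have h1 := hd.weightedAbs_mul_norm_le (A := U * Real.exp (δ * D)) hα hf hM
        (fun ζ hζ => ?_) hzR
      · have hU0 : 0 ≤ U :=
          (mul_nonneg (weightedAbs_nonneg α f 0) (Real.exp_pos _).le).trans (hU 0)
        set T := (N : ℝ) * (2 * r) / (‖z‖ - r)
        have h2 := exp_neg_mul_sq_le hα hC.le (show C ≤ R - dist z w by linarith)
        have h3 : weightedAbs α f z * (slowWeight N δ r z * Real.exp (-T)) ≤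
            U * Real.exp (δ * D) * Real.exp (-α * C ^ 2) :=
          (mul_le_mul_of_nonneg_left (hMge z hzR hzr) (weightedAbs_nonneg α f z)).trans
            (h1.trans (by gcongr))
        calc weightedAbs α f z * slowWeight N δ r z
            = weightedAbs α f z * (slowWeight N δ r z * Real.exp (-T)) * Real.exp T := by
              rw [Real.exp_neg]; field_simp
          _ ≤ U * Real.exp (δ * D) * Real.exp (-α * C ^ 2) * Real.exp T := by gcongr
          _ = U * Real.exp (δ * D + -α * C ^ 2 + T) := by
              rw [Real.exp_add, Real.exp_add]; ring
          _ ≤ U * Real.exp (-(α * C ^ 2 / 2)) := by gcongr; linarith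
          _ = _ := mul_comm _ _
      · calc weightedAbs α f ζ * ‖M ζ‖
            ≤ weightedAbs α f ζ * (slowWeight N δ r ζ * Real.exp (δ * D)) :=
              mul_le_mul_of_nonneg_left (hMle ζ (sphere_subset_closedBall hζ))
                (weightedAbs_nonneg α f ζ)
          _ = weightedAbs α f ζ * slowWeight N δ r ζ * Real.exp (δ * D) := by ring
          _ ≤ U * Real.exp (δ * D) := by gcongr; exact hU ζ
  have hpos : 0 < ‖z‖ + r := by linarith [norm_nonneg z]
  have hlim : Tendsto (fun δ : ℝ => weightedAbs α f z * slowWeight N δ r z) (𝓝[>] 0)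
      (𝓝 (weightedAbs α f z * slowWeight N 0 r z)) := by
    refine Tendsto.mono_left (Continuous.tendsto ?_ 0) nhdsWithin_le_nhds
    unfold slowWeight
    fun_prop
  have hev : ∀ᶠ δ : ℝ in 𝓝[>] 0,
      weightedAbs α f z * slowWeight N δ r z ≤ A * (r₂ + r) ^ N := by
    filter_upwards [Ioc_mem_nhdsGT (show 0 < α * C ^ 2 / 4 / D by positivity)] with δ hδ
    exact hmain δ hδ.1 ((le_div_iff₀ hD0).1 hδ.2) z
  refine le_trans ?_ (le_of_tendsto hlim hev)
  refine mul_le_mul_of_nonneg_left ?_ (weightedAbs_nonneg α f z)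
  rw [slowWeight, zero_mul, sub_zero, Real.exp_nat_mul, Real.exp_log hpos]
  gcongr
  linarith

lemma weightedAbs_eq_zero_iff {α : ℝ} {f : ℂ → ℂ} {z : ℂ} : weightedAbs α f z = 0 ↔ f z = 0 := by
  simp [weightedAbs, (Real.exp_pos _).ne']

/-! ### Uniqueness -/

/-- A function of the Fock space with zero discs covering a neighbourhood of infinity, with a
margin, vanishes identically. -/
theorem eq_zero_of_isZeroDisc_cover {α C r₀ : ℝ} {f : ℂ → ℂ} (hα : 0 < α) (hC : 0 < C)
    (hr₀ : 0 ≤ r₀) (hf : f ∈ space α)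
    (hcov : ∀ z : ℂ, r₀ < ‖z‖ → ∃ w R, IsZeroDisc α f w R ∧ dist z w < R - C) : f = 0 := by
  set A := supNorm α f
  have hA : ∀ z, weightedAbs α f z ≤ A := weightedAbs_le_supNorm hf
  have hA0 : 0 ≤ A := supNorm_nonneg α f
  by_cases hB : ∃ B, 0 ≤ B ∧ ∀ w R, IsZeroDisc α f w R → R ≤ ‖w‖ + B
  · obtain ⟨B, hB, hRB⟩ := hB
    -- Rapid decay supplies the a priori bound `Q`. With the exact multiplier `ζ ^ N` there is no
    -- loss, so the contraction reaches down to `r₀` with a constant `A` independent of `N`.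
    have hN : ∀ (N : ℕ) (z : ℂ), weightedAbs α f z * ‖z‖ ^ N ≤ A * r₀ ^ N := by
      intro N
      obtain ⟨Q, hQ⟩ := exists_weightedAbs_mul_pow_le hα hC hB hf.1 hA hcov hRB N
      refine le_of_forall_le_max (q := Real.exp (-α * C ^ 2))
        ⟨Q, by rintro _ ⟨z, rfl⟩; exact hQ z⟩ (by positivity)
        (exp_neg_mul_sq_lt_one hα hC) ?_
      intro U hU z
      rcases le_or_gt ‖z‖ r₀ with hz | hz
      · refine le_max_of_le_left ?_
        gcongr
        exact hA z
      · refine le_max_of_le_right ?_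
        obtain ⟨w, R, hd, hzw⟩ := hcov z hz
        have h1 := hd.weightedAbs_mul_norm_le (A := U) (M := fun ζ => ζ ^ N) (z := z) hα hf.1
          (by fun_prop : Differentiable ℂ fun ζ : ℂ => ζ ^ N).diffContOnCl
          (fun ζ _ => by simpa using hU ζ) (by rw [mem_closedBall]; linarith)
        have hU0 : 0 ≤ U :=
          (mul_nonneg (weightedAbs_nonneg α f 0) (by positivity)).trans (hU 0)
        rw [norm_pow] at h1
        rw [mul_comm _ U]
        exact h1.trans (mul_le_mul_of_nonneg_left
          (exp_neg_mul_sq_le hα hC.le (by linarith)) hU0)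
    have hzero : ∀ z : ℂ, r₀ < ‖z‖ → f z = 0 := by
      intro z hz
      have hz0 : 0 < ‖z‖ := hr₀.trans_lt hz
      have hlim : Tendsto (fun N : ℕ => A * (r₀ / ‖z‖) ^ N) atTop (𝓝 (A * 0)) :=
        (tendsto_pow_atTop_nhds_zero_of_lt_one (by positivity)
          ((div_lt_one hz0).2 hz)).const_mul A
      have h1 : weightedAbs α f z ≤ A * 0 := ge_of_tendsto' hlim fun N => by
        rw [div_pow, mul_div_assoc', le_div_iff₀ (by positivity)]
        exact hN N z
      rw [mul_zero] at h1
      exact weightedAbs_eq_zero_iff.1 (le_antisymm h1 (weightedAbs_nonneg α f z))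
    have hfa : AnalyticOnNhd ℂ f univ := fun z _ => hf.1.analyticAt z
    refine hfa.eq_of_eventuallyEq (z₀ := ((r₀ + 1 : ℝ) : ℂ)) (fun z _ => analyticAt_const) ?_
    have hopen : IsOpen {z : ℂ | r₀ < ‖z‖} := isOpen_lt continuous_const continuous_norm
    filter_upwards [hopen.mem_nhds (show r₀ < ‖((r₀ + 1 : ℝ) : ℂ)‖ by
      rw [Complex.norm_real, Real.norm_of_nonneg (by linarith)]; linarith)] with z hz
    exact hzero z hz
  · push Not at hB
    ext z
    have hlim : Tendsto (fun n : ℕ => A * Real.exp (-α * (n : ℝ) ^ 2)) atTop (𝓝 (A * 0)) := by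
      refine Tendsto.const_mul A (Real.tendsto_exp_atBot.comp ?_)
      exact ((tendsto_pow_atTop two_ne_zero).comp
        tendsto_natCast_atTop_atTop).const_mul_atTop_of_neg (by linarith)
    have h1 : weightedAbs α f z ≤ A * 0 := ge_of_tendsto' hlim fun n => by
      -- A disc with `R > ‖w‖ + ‖z‖ + n` contains `z` at depth at least `n`.
      obtain ⟨w, R, hd, hR⟩ := hB (‖z‖ + n) (by positivity)
      have h2 : dist z w ≤ ‖z‖ + ‖w‖ := by rw [dist_eq_norm]; exact norm_sub_le z w
      have h3 : (n : ℝ) ≤ R - dist z w := by linarith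
      refine (hd.weightedAbs_le hα hf.1 hA ?_).trans
        (mul_le_mul_of_nonneg_left (exp_neg_mul_sq_le hα n.cast_nonneg h3) hA0)
      rw [mem_closedBall]
      linarith [n.cast_nonneg (α := ℝ)]
    rw [mul_zero] at h1
    exact weightedAbs_eq_zero_iff.1 (le_antisymm h1 (weightedAbs_nonneg α f z))

/-! ### Compactness and limits of almost vanishing functions -/

lemma norm_le_mul_exp {α A : ℝ} {f : ℂ → ℂ} {z : ℂ} (h : weightedAbs α f z ≤ A) :
    ‖f z‖ ≤ A * Real.exp (α / 2 * ‖z‖ ^ 2) := by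
  have h1 : ‖f z‖ = weightedAbs α f z * Real.exp (α / 2 * ‖z‖ ^ 2) := by
    rw [weightedAbs, mul_assoc, ← Real.exp_add]
    ring_nf
    simp
  rw [h1]
  gcongr

lemma norm_le_mul_exp_of_norm_le {α A ρ : ℝ} {f : ℂ → ℂ} {z : ℂ} (hα : 0 < α)
    (h : weightedAbs α f z ≤ A) (hz : ‖z‖ ≤ ρ) : ‖f z‖ ≤ A * Real.exp (α / 2 * ρ ^ 2) := by
  have hA : 0 ≤ A := (weightedAbs_nonneg α f z).trans h
  refine (norm_le_mul_exp h).trans ?_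
  gcongr

lemma norm_sub_le_of_weightedAbs_le {α A : ℝ} {f : ℂ → ℂ} {z₀ x y : ℂ} (hα : 0 < α)
    (hf : Differentiable ℂ f) (h : ∀ z, weightedAbs α f z ≤ A) (hx : x ∈ ball z₀ 1)
    (hy : y ∈ ball z₀ 1) :
    ‖f y - f x‖ ≤ A * Real.exp (α / 2 * (‖z₀‖ + 2) ^ 2) * ‖y - x‖ := by
  refine (convex_ball z₀ 1).norm_image_sub_le_of_norm_deriv_le
    (fun z _ => hf.differentiableAt) (fun z hz => ?_) hx hy
  have := Complex.norm_deriv_le_of_forall_mem_sphere_norm_le (c := z) one_pos hf.diffContOnCl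
    (fun ζ hζ => norm_le_mul_exp_of_norm_le hα (h ζ) (ρ := ‖z₀‖ + 2) ?_)
  · simpa using this
  · rw [mem_ball, dist_eq_norm] at hz
    rw [mem_sphere_iff_norm] at hζ
    have h1 : ζ = z₀ + (z - z₀) + (ζ - z) := by ring
    rw [h1]
    refine (norm_add₃_le).trans ?_
    linarith

/-- A bounded sequence in the Fock space converges locally uniformly along any ultrafilter. -/
theorem exists_tendstoLocallyUniformlyOn {α A : ℝ} (hα : 0 < α) (φ : Ultrafilter ℕ)
    {f : ℕ → ℂ → ℂ} (hf : ∀ n, Differentiable ℂ (f n)) (hA : ∀ n z, weightedAbs α (f n) z ≤ A) :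
    ∃ F ∈ space α, TendstoLocallyUniformlyOn f F φ univ := by
  have hA0 : 0 ≤ A := (weightedAbs_nonneg α (f 0) 0).trans (hA 0 0)
  -- An ultrafilter gives pointwise limits without extracting subsequences; the local Lipschitz
  -- bound, uniform in `n`, upgrades them to locally uniform convergence.
  have hlim : ∀ z, ∃ x, Tendsto (fun n => f n z) φ (𝓝 x) := by
    intro z
    obtain ⟨x, _, hx⟩ := (isCompact_closedBall (0 : ℂ)
      (A * Real.exp (α / 2 * ‖z‖ ^ 2))).ultrafilter_le_nhds' (φ.map fun n => f n z)
      (Ultrafilter.mem_map.2 (Filter.univ_mem' fun n => by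
        simpa using norm_le_mul_exp (hA n z)))
    exact ⟨x, hx⟩
  choose F hF using hlim
  have hloc : TendstoLocallyUniformlyOn f F φ univ := by
    rw [Metric.tendstoLocallyUniformlyOn_iff]
    intro ε hε z₀ _
    set E := A * Real.exp (α / 2 * (‖z₀‖ + 2) ^ 2)
    have hE : 0 ≤ E := by positivity
    have hlip : ∀ n, ∀ y ∈ ball z₀ 1, ‖f n y - f n z₀‖ ≤ E * ‖y - z₀‖ := fun n y hy =>
      norm_sub_le_of_weightedAbs_le hα (hf n) (hA n) (mem_ball_self one_pos) hy
    have hlipF : ∀ y ∈ ball z₀ 1, ‖F y - F z₀‖ ≤ E * ‖y - z₀‖ := fun y hy =>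
      le_of_tendsto ((hF y).sub (hF z₀)).norm (Eventually.of_forall fun n => hlip n y hy)
    have hd : 0 < ε / (3 * (E + 1)) := by positivity
    refine ⟨ball z₀ 1 ∩ ball z₀ (ε / (3 * (E + 1))), mem_nhdsWithin_of_mem_nhds
      (inter_mem (ball_mem_nhds _ one_pos) (ball_mem_nhds _ hd)), ?_⟩
    have hev : ∀ᶠ n in (φ : Filter ℕ), dist (f n z₀) (F z₀) < ε / 3 :=
      (hF z₀).eventually (ball_mem_nhds _ (by positivity))
    filter_upwards [hev] with n hn y hy
    have h1 : E * ‖y - z₀‖ ≤ ε / 3 := by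
      have h2 : ‖y - z₀‖ ≤ ε / (3 * (E + 1)) := by
        have := hy.2
        rw [mem_ball, dist_eq_norm] at this
        exact this.le
      calc E * ‖y - z₀‖ ≤ (E + 1) * (ε / (3 * (E + 1))) := by gcongr; linarith
        _ = ε / 3 := by field_simp
    have h3 := hlip n y hy.1
    have h4 := hlipF y hy.1
    rw [← dist_eq_norm] at h3 h4
    have h5 := dist_triangle4 (F y) (F z₀) (f n z₀) (f n y)
    rw [dist_comm (f n z₀) (F z₀)] at hn
    rw [dist_comm (f n y)] at h3
    linarith
  refine ⟨F, ⟨?_, A, ?_⟩, hloc⟩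
  · rw [← differentiableOn_univ]
    exact hloc.differentiableOn (Eventually.of_forall fun n => (hf n).differentiableOn) isOpen_univ
  · rintro _ ⟨z, rfl⟩
    exact le_of_tendsto ((hF z).norm.mul_const _) (Eventually.of_forall fun n => hA n z)

/-- Failure of the sampling inequality with constant `L` gives a normalised function that is
uniformly close to all the spaces `vanishing α (pt i) (m i)`. -/
lemma exists_normalized_of_lt {ι : Type*} {α L : ℝ} {pt : ι → ℂ} {m : ι → ℕ} {f : ℂ → ℂ}
    (hL : 0 < L) (hf : f ∈ space α) (h : L * ⨆ i, quotNorm α (pt i) (m i) f < supNorm α f) :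
    ∃ F ∈ space α, (∀ z, weightedAbs α F z ≤ 1) ∧ (∀ η < 1, ∃ z, η < weightedAbs α F z) ∧
      ∀ i, ∃ g ∈ vanishing α (pt i) (m i), ∀ z, weightedAbs α (F - g) z ≤ 1 / L := by
  set s := supNorm α f with hs
  have hq0 : 0 ≤ ⨆ i, quotNorm α (pt i) (m i) f :=
    Real.iSup_nonneg fun i => quotNorm_nonneg _ _ _ _
  have hs0 : 0 < s := (mul_nonneg hL.le hq0).trans_lt h
  have hnorm : ‖((s⁻¹ : ℝ) : ℂ)‖ = s⁻¹ := by
    rw [Complex.norm_real, Real.norm_of_nonneg (by positivity)]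
  refine ⟨((s⁻¹ : ℝ) : ℂ) • f, (space α).smul_mem _ hf, fun z => ?_, fun η hη => ?_, fun i => ?_⟩
  · rw [weightedAbs_smul, hnorm, inv_mul_le_iff₀ hs0, mul_one]
    exact weightedAbs_le_supNorm hf z
  · obtain ⟨z, hz⟩ := exists_lt_of_lt_ciSup
      (show s * η < ⨆ z, weightedAbs α f z from (mul_lt_of_lt_one_right hs0 hη))
    refine ⟨z, ?_⟩
    rw [weightedAbs_smul, hnorm, lt_inv_mul_iff₀ hs0]
    exact hz
  · have hb : BddAbove (range fun i => quotNorm α (pt i) (m i) f) :=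
      ⟨s, by rintro _ ⟨i, rfl⟩; exact quotNorm_le_supNorm _ _ _ _⟩
    have h1 : quotNorm α (pt i) (m i) f < s / L := by
      rw [lt_div_iff₀ hL, mul_comm]
      exact (mul_le_mul_of_nonneg_left (le_ciSup hb i) hL.le).trans_lt h
    obtain ⟨⟨g, hg⟩, hlt⟩ := exists_lt_of_ciInf_lt h1
    refine ⟨((s⁻¹ : ℝ) : ℂ) • g, (vanishing α (pt i) (m i)).smul_mem _ hg, fun z => ?_⟩
    rw [← smul_sub, weightedAbs_smul, hnorm, inv_mul_le_iff₀ hs0]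
    refine (weightedAbs_le_supNorm ((space α).sub_mem hf hg.1) z).trans (hlt.le.trans_eq ?_)
    ring

/-- Zeros of given order persist under locally uniform limits, also for functions that are only
asymptotically close to the functions with such zeros. -/
lemma iteratedDeriv_eq_zero_of_tendsto {α : ℝ} (hα : 0 < α) (φ : Filter ℕ) [φ.NeBot]
    (hφ : φ ≤ atTop) {f : ℕ → ℂ → ℂ} {F : ℂ → ℂ} {w : ℂ} {m k : ℕ} (hk : k < m)
    (hF : Differentiable ℂ F) (hlim : TendstoLocallyUniformlyOn f F φ univ)
    (hg : ∀ n, ∃ g ∈ vanishing α w m, ∀ z, weightedAbs α (f n - g) z ≤ 1 / ((n : ℝ) + 1)) :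
    iteratedDeriv k F w = 0 := by
  have hunif := (tendstoLocallyUniformlyOn_iff_forall_isCompact isOpen_univ).1 hlim
    (sphere w 1) (subset_univ _) (isCompact_sphere w 1)
  rw [Metric.tendstoUniformlyOn_iff] at hunif
  set E := Real.exp (α / 2 * (‖w‖ + 1) ^ 2)
  have hbound : ∀ ε > 0, ‖iteratedDeriv k F w‖ ≤ (k.factorial : ℝ) * ε := by
    intro ε hε
    have h0 : Tendsto (fun n : ℕ => 1 / ((n : ℝ) + 1) * E) φ (𝓝 (0 * E)) :=
      (tendsto_one_div_add_atTop_nhds_zero_nat.mul_const E).mono_left hφ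
    rw [zero_mul] at h0
    obtain ⟨n, hn1, hn2⟩ := ((hunif (ε / 2) (by positivity)).and
      (h0.eventually_lt_const (show 0 < ε / 2 by positivity))).exists
    obtain ⟨g, hgv, hgn⟩ := hg n
    -- Subtracting `g` leaves this derivative unchanged, while `F - g` is small on the unit circle
    -- about `w`; Cauchy's estimate applies.
    have hsub : iteratedDeriv k F w = iteratedDeriv k (F - g) w := by
      rw [iteratedDeriv_sub hF.contDiff.contDiffAt hgv.1.1.contDiff.contDiffAt, hgv.2 k hk,
        sub_zero]
    rw [hsub]
    have := Complex.norm_iteratedDeriv_le_of_forall_mem_sphere_norm_le (c := w) (C := ε) k one_pos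
      (hF.sub hgv.1.1).diffContOnCl (fun z hz => ?_)
    · simpa using this
    · have h1 := hn1 z hz
      have hzn : ‖z‖ ≤ ‖w‖ + 1 := by
        rw [mem_sphere_iff_norm] at hz
        calc ‖z‖ = ‖w + (z - w)‖ := by ring_nf
          _ ≤ ‖w‖ + 1 := hz ▸ norm_add_le w (z - w)
      have h2 := norm_le_mul_exp_of_norm_le hα (hgn z) hzn
      rw [dist_eq_norm] at h1
      calc ‖(F - g) z‖ = ‖(F z - f n z) + (f n - g) z‖ := by simp
        _ ≤ ‖F z - f n z‖ + ‖(f n - g) z‖ := norm_add_le _ _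
        _ ≤ ε := by linarith
  have hlim0 : Tendsto (fun ε : ℝ => (k.factorial : ℝ) * ε) (𝓝[>] 0) (𝓝 ((k.factorial : ℝ) * 0)) :=
    Tendsto.mono_left (Continuous.tendsto (by fun_prop) 0) nhdsWithin_le_nhds
  rw [mul_zero] at hlim0
  refine norm_le_zero_iff.1 (ge_of_tendsto hlim0 ?_)
  filter_upwards [self_mem_nhdsWithin] with ε hε using hbound ε hε

/-! ### Part (b): conclusion -/

lemma mul_sq_sqrt_div {α : ℝ} (hα : 0 < α) (m : ℕ) : (m : ℝ) = α * Real.sqrt (m / α) ^ 2 := by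
  rw [Real.sq_sqrt (by positivity)]; field_simp

theorem isSampling_of_compl_subset {ι : Type*} {α C : ℝ} (hα : 0 < α) (hC : 0 < C) {pt : ι → ℂ}
    {m : ι → ℕ} {K : Set ℂ} (hK : IsCompact K)
    (hcov : Kᶜ ⊆ ⋃ i ∈ {i | α * C ^ 2 < (m i : ℝ)}, ball (pt i) (Real.sqrt (m i / α) - C)) :
    IsSampling α pt m := by
  by_contra hns
  unfold IsSampling at hns
  push Not at hns
  have hex : ∀ n : ℕ, ∃ F ∈ space α, (∀ z, weightedAbs α F z ≤ 1) ∧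
      (∀ η < 1, ∃ z, η < weightedAbs α F z) ∧ ∀ i, ∃ g ∈ vanishing α (pt i) (m i),
        ∀ z, weightedAbs α (F - g) z ≤ 1 / ((n : ℝ) + 1) := by
    intro n
    obtain ⟨f, hf, hlt⟩ := hns (n + 1) (by positivity)
    exact exists_normalized_of_lt (by positivity) hf hlt
  choose f hfs hf1 hfη hfg using hex
  have hcover : ∀ z ∉ K, ∃ i, 0 < Real.sqrt (m i / α) ∧
      dist z (pt i) < Real.sqrt (m i / α) - C := by
    intro z hz
    have := hcov hz
    simp only [mem_iUnion, mem_ofPred_eq, mem_ball, exists_prop] at this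
    obtain ⟨i, hi, hzi⟩ := this
    exact ⟨i, by linarith [dist_nonneg (x := z) (y := pt i)], hzi⟩
  set φ := hyperfilter ℕ
  have hφ : (φ : Filter ℕ) ≤ atTop := by
    rw [← Nat.cofinite_eq_atTop]; exact hyperfilter_le_cofinite
  obtain ⟨F, hF, hlim⟩ := exists_tendstoLocallyUniformlyOn hα φ (fun n => (hfs n).1) hf1
  have hF0 : F = 0 := by
    obtain ⟨r₀, hr₀⟩ := hK.isBounded.subset_closedBall (0 : ℂ)
    refine eq_zero_of_isZeroDisc_cover (r₀ := max r₀ 0) hα hC (le_max_right _ _) hF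
      fun z hz => ?_
    obtain ⟨i, hi, hzi⟩ := hcover z fun hzK => by
      have := hr₀ hzK
      rw [mem_closedBall, dist_zero_right] at this
      exact absurd hz (not_lt.2 (this.trans (le_max_left _ _)))
    exact ⟨pt i, _, ⟨hi, m i, mul_sq_sqrt_div hα (m i), fun k hk =>
      iteratedDeriv_eq_zero_of_tendsto hα φ hφ hk hF.1 hlim fun n => hfg n i⟩, hzi⟩
  set q := Real.exp (-α * C ^ 2)
  have hq : q < 1 := exp_neg_mul_sq_lt_one hα hC
  have hq0 : 0 < q := Real.exp_pos _
  -- With `ε = 1 / (n + 1)`, the nearby `g` is at most `1 + ε` everywhere, hence at most `(1 + ε) q`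
  -- at `z`; returning to `f n` costs another `ε`.
  have hout : ∀ n : ℕ, ∀ z ∉ K, weightedAbs α (f n) z ≤ q + 2 * (1 / ((n : ℝ) + 1)) := by
    intro n z hz
    obtain ⟨i, hi, hzi⟩ := hcover z hz
    obtain ⟨g, hg, hgn⟩ := hfg n i
    have hε : 0 < 1 / ((n : ℝ) + 1) := by positivity
    set ε := 1 / ((n : ℝ) + 1)
    have hgd : IsZeroDisc α g (pt i) (Real.sqrt (m i / α)) :=
      ⟨hi, m i, mul_sq_sqrt_div hα (m i), hg.2⟩
    have h1 : ∀ ζ, weightedAbs α g ζ ≤ 1 + ε := fun ζ => by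
      have h2 := weightedAbs_add_le α (f n) (g - f n) ζ
      rw [add_sub_cancel, weightedAbs_sub_comm] at h2
      linarith [hf1 n ζ, hgn ζ]
    have h3 := hgd.weightedAbs_le hα hg.1.1 h1 (z := z) (by rw [mem_closedBall]; linarith)
    have h4 : weightedAbs α g z ≤ (1 + ε) * q := h3.trans
      (mul_le_mul_of_nonneg_left (exp_neg_mul_sq_le hα hC.le (by linarith)) (by linarith))
    have h5 := weightedAbs_add_le α (f n - g) g z
    rw [sub_add_cancel] at h5
    nlinarith [hgn z]
  have hunif := (tendstoLocallyUniformlyOn_iff_forall_isCompact isOpen_univ).1 hlim K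
    (subset_univ _) hK
  rw [Metric.tendstoUniformlyOn_iff] at hunif
  have h0 : Tendsto (fun n : ℕ => q + 2 * (1 / ((n : ℝ) + 1))) φ (𝓝 (q + 2 * 0)) :=
    ((tendsto_one_div_add_atTop_nhds_zero_nat.const_mul 2).const_add q).mono_left hφ
  obtain ⟨n, hn1, hn2⟩ := ((hunif q hq0).and
    (h0.eventually_lt_const (show q + 2 * 0 < 1 by linarith))).exists
  -- The level `q + 2ε` is below `1`, so it is exceeded somewhere: not off `K` by `hout`, and not on
  -- `K`, where `f n` is smaller than `q`.
  obtain ⟨z, hz⟩ := hfη n _ hn2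
  by_cases hzK : z ∈ K
  · have h1 := hn1 z hzK
    rw [hF0, Pi.zero_apply, dist_zero_left] at h1
    have h2 : weightedAbs α (f n) z ≤ ‖f n z‖ := by
      refine mul_le_of_le_one_right (norm_nonneg _) (Real.exp_le_one_iff.2 ?_)
      nlinarith [sq_nonneg ‖z‖]
    have h3 : 0 < 1 / ((n : ℝ) + 1) := by positivity
    linarith
  · exact absurd hz (not_lt.2 (hout n z hzK))

end Fock

end

theorem theorem1p5 {ι : Type*} [Countable ι] (α : ℝ) (hα : 0 < α) (pt : ι → ℂ) (m : ι → ℕ) :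
    (Fock.IsSampling α pt m →
      ∃ C : ℝ, 0 < C ∧ ⋃ i, Metric.ball (pt i) (Real.sqrt (m i / α) + C) = Set.univ) ∧
    (∀ C : ℝ, 0 < C → ∀ K : Set ℂ, IsCompact K →
      Kᶜ ⊆ ⋃ i ∈ {i | α * C ^ 2 < (m i : ℝ)}, Metric.ball (pt i) (Real.sqrt (m i / α) - C) →
      Fock.IsSampling α pt m) :=
  ⟨fun h => h.exists_iUnion_ball_eq_univ hα,
    fun _ hC _ hK hcov => Fock.isSampling_of_compl_subset hα hC hK hcov⟩
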